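/- Graphs are finite and simple, and $\log$ is the natural logarithm. For positive integers $n,k$, an $(n,k)$-graph is a graph whose vertex set is a disjoint union of $n$ independent sets (blobs), each of size at most $k$, with exactly one edge between any two distinct blobs. For a graph $H$ let $f(n,H)$ be the least positive integer $k$ for which there is an $(n,k)$-graph that does not contain $H$ as a (not necessarily induced) subgraph; if $H$ is not a forest, such a $k$ exists for every $n$. Let $\mathrm{ex}(\ell,H)$ be the largest number of edges of a graph on $\ell$ vertices that does not contain $H$ as a subgraph. **Theorem.** Let $H$ be a bipartite graph that is not a forest. Suppose that there are constants $C,C'>0$ and real exponents $a,b$ with $b<2$ and $$b-a<\frac{(2-b)(b-1)}{5-b}$$ such that $C\ell^a\le \mathrm{ex}(\ell,H)\le C'\ell^b$ for all sufficiently large $\ell$. Then: 1. If $\mathrm{ex}(nk,H)\ge 12n^2\log n$, then $f(n,H)\le k+o(k)$ as $n\to\infty$, uniformly in $k$. That is, for every $\varepsilon>0$ there is an $n_0$ such that for all $n\ge n_0$ and all $k$ with $\mathrm{ex}(nk,H)\ge 12n^2\log n$ one has $f(n,H)\le(1+\varepsilon)k$. 2. For all $n\ge|V(H)|$ and all $k$: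 if $\mathrm{ex}(nk,H)<\binom n2$, then $f(n,H)\ge k$. -/

import Mathlib

open Filter

/-- `G` is an `(n,k)`-graph: its vertex set is split into `n` blobs (the colour classes of a proper
colouring, so that each blob is independent), each of size at most `k`, with exactly one edge
between any two distinct blobs. -/
def IsNKGraph {V : Type*} (G : SimpleGraph V) (n k : ℕ) : Prop :=
  ∃ blob : G.Coloring (Fin n),
    (∀ i, (blob.colorClass i).encard ≤ k) ∧
    ∀ i j, i ≠ j → ∃! e : V × V, blob e.1 = i ∧ blob e.2 = j ∧ G.Adj e.1 e.2

/-- The positive integers `k` for which there is an `H`-free `(n,k)`-graph (which is finite, as it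
has at most `n * k` vertices). -/
def splitSizes {W : Type*} (n : ℕ) (H : SimpleGraph W) : Set ℕ :=
  {k | 0 < k ∧ ∃ (V : Type) (G : SimpleGraph V), IsNKGraph G n k ∧ H.Free G}

/-- `f(n,H)`, the least positive integer `k` for which there is an `H`-free `(n,k)`-graph. -/
noncomputable def splitNumber {W : Type*} (n : ℕ) (H : SimpleGraph W) : ℕ :=
  sInf (splitSizes n H)

/-- If `H` is not a forest, the minimum defining `f(n,H)` is over a nonempty set. -/
theorem splitSizes_nonempty {W : Type*} (n : ℕ) (H : SimpleGraph W) (hH : ¬ H.IsAcyclic) :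
    (splitSizes n H).Nonempty := by
  let G : SimpleGraph (Fin n × Fin n) :=
    { Adj := fun x y => x.1 ≠ x.2 ∧ y = (x.2, x.1)
      symm := ⟨by
        rintro ⟨a, b⟩ ⟨c, d⟩ ⟨h, h'⟩
        simp only [Prod.mk.injEq] at h' ⊢
        exact ⟨by rw [h'.1, h'.2]; exact fun e => h e.symm, h'.2.symm, h'.1.symm⟩⟩
      loopless := ⟨by
        rintro ⟨a, b⟩ ⟨h, h'⟩
        simp only [Prod.mk.injEq] at h'
        exact h h'.1⟩ }
  let blob : G.Coloring (Fin n) := SimpleGraph.Coloring.mk Prod.fst (by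
    rintro ⟨a, b⟩ ⟨c, d⟩ ⟨h, h'⟩
    simp only [Prod.mk.injEq] at h'
    rw [h'.1]
    exact h)
  refine ⟨n + 1, Nat.succ_pos n, Fin n × Fin n, G, ⟨blob, ?_, ?_⟩, ?_⟩
  · intro i
    have hsub : blob.colorClass i ⊆ (fun b => (i, b)) '' (Set.univ : Set (Fin n)) := by
      rintro ⟨a, b⟩ h
      exact ⟨b, trivial, by rw [show a = i from h]⟩
    refine (Set.encard_le_encard hsub).trans ((Set.encard_image_le _ _).trans ?_)
    rw [Set.encard_univ, ENat.card_eq_coe_fintype_card, Fintype.card_fin]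
    exact_mod_cast Nat.le_succ n
  · intro i j hij
    refine ⟨((i, j), (j, i)), ⟨rfl, rfl, hij, rfl⟩, ?_⟩
    rintro ⟨⟨a, b⟩, ⟨c, d⟩⟩ ⟨h1, h2, h3, h4⟩
    change a = i at h1
    change c = j at h2
    simp only [Prod.mk.injEq] at h4
    obtain ⟨h5, h6⟩ := h4
    subst h1 h2 h5 h6
    rfl
  · rintro ⟨φ⟩
    apply hH
    intro v p hp
    apply hp.snd_ne_penultimate
    have h1 := φ.toHom.map_adj (p.adj_snd hp.not_nil)
    have h2 := φ.toHom.map_adj (p.adj_penultimate hp.not_nil).symm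
    exact φ.injective (h1.2.trans h2.2.symm)

/-! Upper bound: let k₀ be least with ex(nk₀, H) ≥ 12n² log n, and colour the N = nk₀ vertices of an
extremal H-free graph uniformly with n colours. Since b < 2, k₀ is at least of the order of a
positive power of n, so by Chernoff some colouring has all classes of size at most (1 + ε)k₀; if
moreover any two classes are joined, keeping one edge per pair gives the required graph. For the
joining, fix a cut (A, Aᶜ) and expose the vertices of A coloured i: they typically have many
neighbours outside A, all of which would have to avoid colour j. `sum_powerset_coverage_le` makes
this quantitative when all degrees are at most n/100, and the failure probability n^(-11/4) beats
the n² pairs of colours.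

Vertices of degree above n/100 are discarded beforehand. `sum_degree_of_large_degree_le` bounds
their degree sum by a power of N and N/n. Minimality of k₀ and the lower bound on ex give N^θ ≤ n,
and the condition on b - a makes the discarded part negligible against N^a.

Lower bound: an H-free (n,K)-graph has at most nK vertices and at least one edge per pair of blobs,
so ex(nK, H) ≥ n(n-1)/2. -/

/-! ### Random colourings: unjoined pairs of classes and oversized classes. -/

/-- One step of the Janson-type induction. -/
theorem one_sub_add_mul_pow_mul_exp_le {p D : ℝ} (hp : 0 < p) (hp1 : p ≤ 1)
    (hpD : p * D ≤ 1 / 100) {w : ℕ} (hw : (w : ℝ) ≤ D) :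
    (1 - p) + p * ((1 - p) ^ w * Real.exp (p ^ 2 / 2 * (w * D)))
      ≤ Real.exp (-(p ^ 2 / 2 * w)) := by
  have hw0 : (0 : ℝ) ≤ w := Nat.cast_nonneg w
  have h1 : (1 - p) ^ w ≤ Real.exp (-(p * w)) := by
    calc (1 - p) ^ w ≤ Real.exp (-p) ^ w :=
          pow_le_pow_left₀ (by linarith) (Real.one_sub_le_exp_neg p) w
      _ = Real.exp (-(p * w)) := by rw [← Real.exp_nat_mul]; ring_nf
  have hx0 : 0 ≤ p * w := by positivity
  have hx1 : p * w ≤ 1 / 100 := (mul_le_mul_of_nonneg_left hw hp.le).trans hpD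
  -- As pD ≤ 1/100, the correction p²wD/2 costs only pw/200 of the exponent -pw. The slope 9/10 then
  -- leaves ample room above the 1/2 needed at the end.
  have h2 : (1 - p) ^ w * Real.exp (p ^ 2 / 2 * (w * D)) ≤ 1 - 9 / 10 * (p * w) := by
    calc (1 - p) ^ w * Real.exp (p ^ 2 / 2 * (w * D))
        ≤ Real.exp (-(p * w)) * Real.exp (p ^ 2 / 2 * (w * D)) := by gcongr
      _ = Real.exp (-(p * w) + p ^ 2 / 2 * (w * D)) := (Real.exp_add _ _).symm
      _ ≤ Real.exp (-(199 / 200 * (p * w))) := by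
          apply Real.exp_le_exp.2
          nlinarith [mul_le_mul_of_nonneg_left hpD hx0]
      _ ≤ 1 - 9 / 10 * (p * w) := by
          have h4 := Real.add_one_le_exp (199 / 200 * (p * w))
          have h5 : Real.exp (-(199 / 200 * (p * w))) * Real.exp (199 / 200 * (p * w)) = 1 := by
            rw [← Real.exp_add]; simp
          have h6 : 0 < Real.exp (-(199 / 200 * (p * w))) := Real.exp_pos _
          have h7 : Real.exp (-(199 / 200 * (p * w))) * (199 / 200 * (p * w) + 1) ≤ 1 := by
            exact (mul_le_mul_of_nonneg_left h4 h6.le).trans_eq h5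
          by_contra hcon
          push Not at hcon
          have h8 : (1 - 9 / 10 * (p * w)) * (199 / 200 * (p * w) + 1) ≤ 1 :=
            (mul_le_mul_of_nonneg_right hcon.le (by positivity)).trans h7
          rcases hx0.eq_or_lt with h | h
          · rw [← h] at hcon; simp at hcon
          · nlinarith
  have h9 := Real.one_sub_le_exp_neg (p ^ 2 / 2 * w)
  have h10 : 0 ≤ p ^ 2 * w := by positivity
  have h11 := mul_le_mul_of_nonneg_left h2 hp.le
  nlinarith

open Finset in
/-- A lower-tail estimate for coverage: if `S` is a `p`-random subset of `s`, then the expectation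
of `(1 - p) ^ |N(S) ∩ R|` decays exponentially in the number of edges between `s` and `R`. -/
theorem sum_powerset_coverage_le {α β : Type*} [DecidableEq α] [DecidableEq β]
    (nb : α → Finset β) {p D : ℝ} (hp : 0 < p) (hp1 : p ≤ 1) (hpD : p * D ≤ 1 / 100)
    (s : Finset α) (hs : ∀ u ∈ s, (#(nb u) : ℝ) ≤ D) (R : Finset β)
    (hR : ∀ v ∈ R, (#{u ∈ s | v ∈ nb u} : ℝ) ≤ D) :
    ∑ S ∈ s.powerset, p ^ #S * (1 - p) ^ #(s \ S) * (1 - p) ^ #(R ∩ S.biUnion nb)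
      ≤ Real.exp (-(p ^ 2 / 2 * ∑ u ∈ s, (#(R ∩ nb u) : ℝ))) := by
  induction s using Finset.induction_on generalizing R with
  | empty => simp
  | insert u s hu ih =>
    have hs' : ∀ u ∈ s, (#(nb u) : ℝ) ≤ D := fun x hx => hs x (mem_insert_of_mem hx)
    have hmono : ∀ v, #{x ∈ s | v ∈ nb x} ≤ #{x ∈ insert u s | v ∈ nb x} := fun v =>
      card_le_card (filter_subset_filter _ (subset_insert _ _))
    have hR1 : ∀ v ∈ R, (#{x ∈ s | v ∈ nb x} : ℝ) ≤ D := fun v hv =>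
      (Nat.cast_le.2 (hmono v)).trans (hR v hv)
    have ih1 := ih hs' R hR1
    have ih2 := ih hs' (R \ nb u) fun v hv => hR1 v (Finset.mem_sdiff.1 hv).1
    set w : ℕ := #(R ∩ nb u) with hw
    set E : ℝ := ∑ x ∈ s, (#(R ∩ nb x) : ℝ) with hE
    have hwD : (w : ℝ) ≤ D :=
      (Nat.cast_le.2 (card_le_card inter_subset_right)).trans (hs u (mem_insert_self _ _))
    -- Removing the w vertices of `R ∩ nb u` from R destroys at most D edges for each of them.
    have hsplit : E - w * D ≤ ∑ x ∈ s, (#((R \ nb u) ∩ nb x) : ℝ) := by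
      have h1 : ∑ x ∈ s, (#((R ∩ nb u) ∩ nb x) : ℝ) ≤ w * D := by
        have h2 : ∑ x ∈ s, #((R ∩ nb u) ∩ nb x) = ∑ v ∈ R ∩ nb u, #{x ∈ s | v ∈ nb x} := by
          rw [show ∑ v ∈ R ∩ nb u, #{x ∈ s | v ∈ nb x}
              = ∑ v ∈ R ∩ nb u, #(s.bipartiteBelow (fun x v => v ∈ nb x) v) from rfl,
            ← sum_card_bipartiteAbove_eq_sum_card_bipartiteBelow]
          refine sum_congr rfl fun x _ => ?_
          rw [← filter_mem_eq_inter]; rfl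
        have h3 : (∑ x ∈ s, (#((R ∩ nb u) ∩ nb x) : ℝ))
            = ∑ v ∈ R ∩ nb u, (#{x ∈ s | v ∈ nb x} : ℝ) := by exact_mod_cast h2
        rw [h3, hw, ← nsmul_eq_mul]
        exact sum_le_card_nsmul _ _ _ fun v hv => hR1 v (mem_inter.1 hv).1
      have h4 : E = ∑ x ∈ s, (#((R ∩ nb u) ∩ nb x) : ℝ)
          + ∑ x ∈ s, (#((R \ nb u) ∩ nb x) : ℝ) := by
        rw [hE, ← sum_add_distrib]
        refine sum_congr rfl fun x _ => ?_
        rw [← Nat.cast_add, ← card_union_of_disjoint, ← union_inter_distrib_right,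
          union_comm, sdiff_union_inter]
        exact (disjoint_sdiff_inter R (nb u)).symm.mono inter_subset_left inter_subset_left
      linarith
    -- Condition on u: if u is not chosen, R is unchanged; if it is, w vertices of R are covered and
    -- the induction continues with `R \ nb u`.
    have hA : ∑ S ∈ s.powerset, p ^ #S * (1 - p) ^ #(insert u s \ S)
          * (1 - p) ^ #(R ∩ S.biUnion nb)
        = (1 - p) * ∑ S ∈ s.powerset, p ^ #S * (1 - p) ^ #(s \ S)
          * (1 - p) ^ #(R ∩ S.biUnion nb) := by
      rw [mul_sum]
      refine sum_congr rfl fun S hS => ?_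
      have huS : u ∉ S := fun h => hu (mem_powerset.1 hS h)
      rw [insert_sdiff_of_notMem _ huS, card_insert_of_notMem (by simp [hu]), pow_succ]
      ring
    have hB : ∑ S ∈ s.powerset, p ^ #(insert u S) * (1 - p) ^ #(insert u s \ insert u S)
          * (1 - p) ^ #(R ∩ (insert u S).biUnion nb)
        = p * (1 - p) ^ w * ∑ S ∈ s.powerset, p ^ #S * (1 - p) ^ #(s \ S)
          * (1 - p) ^ #((R \ nb u) ∩ S.biUnion nb) := by
      rw [mul_sum]
      refine sum_congr rfl fun S hS => ?_
      have huS : u ∉ S := fun h => hu (mem_powerset.1 hS h)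
      have h1 : insert u s \ insert u S = s \ S := by
        ext x; simp only [Finset.mem_sdiff, mem_insert]
        constructor
        · rintro ⟨h | h, h'⟩ <;> tauto
        · rintro ⟨h, h'⟩
          exact ⟨Or.inr h, fun h2 => h2.elim (fun h3 => hu (h3 ▸ h)) h'⟩
      have h2 : #(R ∩ (insert u S).biUnion nb) = w + #((R \ nb u) ∩ S.biUnion nb) := by
        rw [hw, ← card_union_of_disjoint]
        · congr 1
          rw [biUnion_insert]
          ext x; simp only [mem_inter, mem_union, Finset.mem_sdiff]; tauto
        · exact (disjoint_sdiff_inter R (nb u)).symm.mono le_rfl inter_subset_left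
      rw [h1, h2, card_insert_of_notMem huS, pow_succ, pow_add]
      ring
    rw [sum_powerset_insert hu, hA, hB, sum_insert hu]
    have hq : 0 ≤ 1 - p := by linarith
    calc _ ≤ (1 - p) * Real.exp (-(p ^ 2 / 2 * E))
          + p * (1 - p) ^ w * Real.exp (-(p ^ 2 / 2 * (E - w * D))) := by
          gcongr
          refine ih2.trans (Real.exp_le_exp.2 ?_)
          gcongr
      _ = Real.exp (-(p ^ 2 / 2 * E)) * ((1 - p)
          + p * ((1 - p) ^ w * Real.exp (p ^ 2 / 2 * (w * D)))) := by
          rw [show -(p ^ 2 / 2 * (E - w * D)) = -(p ^ 2 / 2 * E) + p ^ 2 / 2 * (w * D) by ring,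
            Real.exp_add]
          ring
      _ ≤ Real.exp (-(p ^ 2 / 2 * E)) * Real.exp (-(p ^ 2 / 2 * w)) := by
          gcongr
          exact one_sub_add_mul_pow_mul_exp_le hp hp1 hpD hwD
      _ = _ := by rw [← Real.exp_add]; congr 1; ring

open Finset in
/-- Counting form: among all colourings `V → Fin n`, few have no edge from a vertex of `A` coloured
`i` to a vertex outside `A` coloured `j`. -/
theorem card_colorings_avoiding_le {V : Type*} [Fintype V] [DecidableEq V] (nb : V → Finset V)
    {n : ℕ} (hn : 0 < n) {D : ℝ} (hD : D ≤ n / 100)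
    (hdeg : ∀ u, (#(nb u) : ℝ) ≤ D) (hsymm : ∀ u v, v ∈ nb u ↔ u ∈ nb v)
    (A : Finset V) (i j : Fin n) :
    (#{φ : V → Fin n | ∀ u ∈ A, ∀ v ∈ nb u, v ∉ A → φ u = i → φ v ≠ j} : ℝ)
      ≤ (n : ℝ) ^ Fintype.card V
        * Real.exp (-((∑ u ∈ A, (#(nb u \ A) : ℝ)) / (2 * (n : ℝ) ^ 2))) := by
  have hn' : (0 : ℝ) < n := Nat.cast_pos.2 hn
  set p : ℝ := 1 / n with hp
  have key := sum_powerset_coverage_le nb (p := p) (D := D) (by positivity)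
    (by rw [hp, div_le_one hn']; exact_mod_cast hn)
    (by rw [hp, one_div, inv_mul_le_iff₀ hn']; linarith) A (fun u _ => hdeg u) Aᶜ
    (fun v _ => by
      refine le_trans (Nat.cast_le.2 (card_le_card ?_)) (hdeg v)
      intro u hu
      rw [mem_filter] at hu
      exact (hsymm u v).1 hu.2)
  -- Once the set S of vertices of A coloured i is fixed, the constraints on different vertices are
  -- independent, so the colourings lie in a product set.
  let box : Finset V → V → Finset (Fin n) := fun S v =>
    if v ∈ A then (if v ∈ S then {i} else {i}ᶜ)
    else (if v ∈ S.biUnion nb then {j}ᶜ else univ)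
  have hsub : ({φ : V → Fin n | ∀ u ∈ A, ∀ v ∈ nb u, v ∉ A → φ u = i → φ v ≠ j} : Finset _)
      ⊆ A.powerset.biUnion fun S => Fintype.piFinset (box S) := by
    intro φ hφ
    rw [mem_filter] at hφ
    refine mem_biUnion.2 ⟨{u ∈ A | φ u = i}, by simp, ?_⟩
    rw [Fintype.mem_piFinset]
    intro v
    by_cases hvA : v ∈ A
    · by_cases hv : φ v = i <;> simp [box, hvA, hv]
    · simp only [box, if_neg hvA]
      split_ifs with h
      · obtain ⟨u, hu, huv⟩ := mem_biUnion.1 h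
        rw [mem_filter] at hu
        simpa using hφ.2 u hu.1 v huv hvA hu.2
      · simp
  have hcard : ∀ S ∈ A.powerset, (#(Fintype.piFinset (box S)) : ℝ)
      = (n : ℝ) ^ Fintype.card V * (p ^ #S * (1 - p) ^ #(A \ S) * (1 - p) ^ #(Aᶜ ∩ S.biUnion nb)) := by
    intro S hS
    have hSA := mem_powerset.1 hS
    have hb : ∀ v, (#(box S v) : ℝ) = n * (if v ∈ A then (if v ∈ S then p else 1 - p)
        else (if v ∈ S.biUnion nb then 1 - p else 1)) := by
      intro v
      have h1 : (n : ℝ) * p = 1 := by rw [hp]; field_simp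
      have h2 : ∀ c : Fin n, (#({c}ᶜ : Finset (Fin n)) : ℝ) = n * (1 - p) := by
        intro c
        rw [card_compl, Fintype.card_fin, card_singleton, Nat.cast_sub hn]
        push_cast; linarith
      simp only [box]
      split_ifs
      · simp [h1]
      · exact h2 i
      · exact h2 j
      · simp
    rw [Fintype.card_piFinset, Nat.cast_prod, prod_congr rfl fun v _ => hb v, prod_mul_distrib,
      prod_const, card_univ]
    congr 1
    rw [← prod_mul_prod_compl A]
    congr 1
    · rw [prod_congr rfl fun v hv => if_pos hv, prod_ite, prod_const, prod_const,
        filter_mem_eq_inter, inter_eq_right.2 hSA, ← sdiff_eq_filter]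
    · rw [prod_congr rfl fun v hv => if_neg (mem_compl.1 hv), prod_ite, prod_const, prod_const,
        filter_mem_eq_inter, one_pow, mul_one]
  calc _ ≤ (#(A.powerset.biUnion fun S => Fintype.piFinset (box S)) : ℝ) :=
        Nat.cast_le.2 (card_le_card hsub)
    _ ≤ ∑ S ∈ A.powerset, (#(Fintype.piFinset (box S)) : ℝ) := by
        exact_mod_cast card_biUnion_le
    _ = (n : ℝ) ^ Fintype.card V * ∑ S ∈ A.powerset,
          (p ^ #S * (1 - p) ^ #(A \ S) * (1 - p) ^ #(Aᶜ ∩ S.biUnion nb)) := by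
        rw [mul_sum, sum_congr rfl hcard]
    _ ≤ _ := by
        refine mul_le_mul_of_nonneg_left (key.trans_eq ?_) (by positivity)
        congr 2
        have : ∀ u, Aᶜ ∩ nb u = nb u \ A := fun u => by ext; simp [and_comm]
        simp_rw [this]
        generalize ∑ u ∈ A, (#(nb u \ A) : ℝ) = X
        rw [hp]
        field_simp

open Finset in
/-- Chernoff bound: few colourings of `n * k` vertices have more than `(1 + ε) * k` vertices of
colour `i`. -/
theorem card_colorings_large_class_le {V : Type*} [Fintype V] [DecidableEq V]
    {n k : ℕ} (hn : 0 < n) (hV : Fintype.card V = n * k) {ε : ℝ} (hε : 0 < ε) (hε1 : ε ≤ 1)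
    (i : Fin n) :
    (#{φ : V → Fin n | (1 + ε) * k < #{v | φ v = i}} : ℝ)
      ≤ (n : ℝ) ^ Fintype.card V * Real.exp (-(ε ^ 2 / 4 * k)) := by
  have hn' : (0 : ℝ) < n := Nat.cast_pos.2 hn
  -- This t minimises t + t² - t(1 + ε), with value -ε²/4.
  set t : ℝ := ε / 2 with ht
  have hexp : Real.exp t - 1 ≤ t + t ^ 2 := by
    have h := Real.abs_exp_sub_one_sub_id_le (x := t) (by rw [abs_of_pos] <;> linarith)
    have := (abs_le.1 h).2
    linarith
  have hsum : ∑ φ : V → Fin n, Real.exp (t * #{v | φ v = i})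
      = (n - 1 + Real.exp t) ^ Fintype.card V := by
    have h1 : ∀ φ : V → Fin n, Real.exp (t * #{v | φ v = i})
        = ∏ v, (if φ v = i then Real.exp t else 1) := by
      intro φ
      rw [prod_ite, prod_const, prod_const, one_pow, mul_one, mul_comm, Real.exp_nat_mul]
    simp_rw [h1]
    rw [← Fintype.prod_sum (fun (_ : V) (c : Fin n) => if c = i then Real.exp t else (1 : ℝ)),
      prod_const, card_univ]
    congr 1
    rw [sum_ite, filter_eq', if_pos (mem_univ i), sum_const, sum_const, card_singleton,
      filter_ne', card_erase_of_mem (mem_univ i), card_univ, Fintype.card_fin, one_smul,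
      nsmul_eq_mul, Nat.cast_sub hn]
    push_cast; ring
  have hmarkov : (#{φ : V → Fin n | (1 + ε) * k < #{v | φ v = i}} : ℝ)
      * Real.exp (t * ((1 + ε) * k)) ≤ ∑ φ : V → Fin n, Real.exp (t * #{v | φ v = i}) := by
    rw [← nsmul_eq_mul]
    calc _ ≤ ∑ φ ∈ ({φ : V → Fin n | (1 + ε) * k < #{v | φ v = i}} : Finset _),
            Real.exp (t * #{v | φ v = i}) := by
          refine card_nsmul_le_sum _ _ _ fun φ hφ => ?_
          rw [mem_filter] at hφ
          apply Real.exp_le_exp.2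
          have := hφ.2
          gcongr
      _ ≤ _ := sum_le_univ_sum_of_nonneg fun φ => (Real.exp_pos _).le
  have hpow : (n - 1 + Real.exp t) ^ Fintype.card V
      ≤ (n : ℝ) ^ Fintype.card V * Real.exp (k * (t + t ^ 2)) := by
    have h1 : (n - 1 + Real.exp t) = n * (1 + (Real.exp t - 1) / n) := by field_simp; ring
    have h0 : 0 ≤ (Real.exp t - 1) / n :=
      div_nonneg (by linarith [Real.add_one_le_exp t]) hn'.le
    rw [h1, mul_pow]
    gcongr
    calc (1 + (Real.exp t - 1) / n) ^ Fintype.card V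
        ≤ Real.exp ((Real.exp t - 1) / n) ^ Fintype.card V := by
          gcongr
          linarith [Real.add_one_le_exp ((Real.exp t - 1) / n)]
      _ = Real.exp (k * (Real.exp t - 1)) := by
          rw [← Real.exp_nat_mul, hV]; congr 1; push_cast; field_simp
      _ ≤ _ := by gcongr
  rw [hsum] at hmarkov
  have h := hmarkov.trans hpow
  rw [← le_div_iff₀ (Real.exp_pos _), mul_div_assoc, ← Real.exp_sub] at h
  refine h.trans_eq ?_
  congr 2
  rw [ht]; ring

/-! ### Large cuts, and (n,k)-graphs from colourings. -/

open Finset in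
/-- Every symmetric weight has a cut carrying at least half of its total. -/
theorem exists_large_cut {V : Type*} [DecidableEq V] (g : V → V → ℕ)
    (hsymm : ∀ u v, g u v = g v u) (hdiag : ∀ u, g u u = 0) (s : Finset V) :
    ∃ A ⊆ s, ∑ u ∈ s, ∑ v ∈ s, g u v ≤ 4 * ∑ u ∈ A, ∑ v ∈ s \ A, g u v := by
  induction s using Finset.induction_on with
  | empty => exact ⟨∅, by simp⟩
  | insert x s hx ih =>
    obtain ⟨A, hA, h⟩ := ih
    have htot : ∑ u ∈ insert x s, ∑ v ∈ insert x s, g u v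
        = ∑ u ∈ s, ∑ v ∈ s, g u v + 2 * ∑ v ∈ s, g x v := by
      rw [sum_insert hx, sum_insert hx, hdiag]
      have : ∑ u ∈ s, ∑ v ∈ insert x s, g u v = ∑ u ∈ s, g x u + ∑ u ∈ s, ∑ v ∈ s, g u v := by
        rw [← sum_add_distrib]
        exact sum_congr rfl fun u _ => by rw [sum_insert hx, hsymm]
      rw [this]; ring
    have hxs : ∑ v ∈ s, g x v = ∑ v ∈ s \ A, g x v + ∑ v ∈ A, g x v := (sum_sdiff hA).symm
    have hxA : x ∉ A := fun h => hx (hA h)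
    -- Greedy choice: x joins the side to which it sends less weight. The constant is 4 because the
    -- full double sum counts each pair twice and the cut sum once.
    rcases le_total (∑ v ∈ s \ A, g x v) (∑ v ∈ A, g x v) with hle | hle
    · refine ⟨A, hA.trans (subset_insert _ _), ?_⟩
      rw [insert_sdiff_of_notMem _ hxA]
      have : ∑ u ∈ A, ∑ v ∈ insert x (s \ A), g u v
          = ∑ u ∈ A, g x u + ∑ u ∈ A, ∑ v ∈ s \ A, g u v := by
        rw [← sum_add_distrib]
        exact sum_congr rfl fun u _ => by rw [sum_insert (by simp [hx]), hsymm]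
      rw [this, htot]; omega
    · refine ⟨insert x A, insert_subset_insert _ hA, ?_⟩
      have h1 : insert x s \ insert x A = s \ A := by
        ext y; simp only [Finset.mem_sdiff, mem_insert]
        constructor
        · rintro ⟨h | h, h'⟩ <;> tauto
        · rintro ⟨h, h'⟩
          exact ⟨Or.inr h, fun h2 => h2.elim (fun h3 => hx (h3 ▸ h)) h'⟩
      rw [h1, sum_insert hxA, htot]; omega

/-- A colouring of an `H`-free graph with small classes, any two of which are joined by an edge,
yields an `H`-free `(n, K)`-graph. -/
theorem mem_splitSizes_of_coloring {W : Type*} {H : SimpleGraph W} {V : Type} {G : SimpleGraph V}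
    (hG : H.Free G) {n K : ℕ} (hK : 0 < K) (φ : V → Fin n)
    (hsize : ∀ i, {v | φ v = i}.encard ≤ K)
    (hedge : ∀ i j, i < j → ∃ u v, φ u = i ∧ φ v = j ∧ G.Adj u v) : K ∈ splitSizes n H := by
  choose x y hx hy hxy using hedge
  let G' : SimpleGraph V :=
    { Adj := fun u v => ∃ i j, ∃ h : i < j, (u = x i j h ∧ v = y i j h) ∨ (v = x i j h ∧ u = y i j h)
      symm := ⟨fun u v ⟨i, j, h, h'⟩ => ⟨i, j, h, h'.symm⟩⟩
      loopless := ⟨by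
        rintro u ⟨i, j, h, ⟨h1, h2⟩ | ⟨h1, h2⟩⟩ <;>
          exact h.ne ((hx i j h).symm.trans ((congrArg φ (h1.symm.trans h2)).trans (hy i j h)))⟩ }
  have hle : G' ≤ G := by
    rintro u v ⟨i, j, h, ⟨rfl, rfl⟩ | ⟨rfl, rfl⟩⟩
    · exact hxy i j h
    · exact (hxy i j h).symm
  have hcol : ∀ {u v}, G'.Adj u v → φ u ≠ φ v := by
    rintro u v ⟨i, j, h, ⟨rfl, rfl⟩ | ⟨rfl, rfl⟩⟩
    · rw [hx, hy]; exact h.ne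
    · rw [hx, hy]; exact h.ne'
  refine ⟨hK, V, G', ⟨SimpleGraph.Coloring.mk φ hcol, hsize, ?_⟩,
    fun h => hG (h.trans (SimpleGraph.IsContained.of_le hle))⟩
  intro i j hij
  change ∃! e : V × V, φ e.1 = i ∧ φ e.2 = j ∧ G'.Adj e.1 e.2
  rcases lt_or_gt_of_ne hij with h | h
  · refine ⟨(x i j h, y i j h), ⟨hx _ _ _, hy _ _ _, i, j, h, Or.inl ⟨rfl, rfl⟩⟩, ?_⟩
    rintro ⟨u, v⟩ ⟨hu, hv, i', j', h', ⟨h1, h2⟩ | ⟨h1, h2⟩⟩ <;> dsimp only at hu hv h1 h2 <;>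
      subst h1 h2 <;> rw [hx] at * <;> rw [hy] at * <;> subst hu hv
    · rfl
    · exact absurd h h'.asymm
  · refine ⟨(y j i h, x j i h), ⟨hy _ _ _, hx _ _ _, j, i, h, Or.inr ⟨rfl, rfl⟩⟩, ?_⟩
    rintro ⟨u, v⟩ ⟨hu, hv, i', j', h', ⟨h1, h2⟩ | ⟨h1, h2⟩⟩ <;> dsimp only at hu hv h1 h2 <;>
      subst h1 h2 <;> rw [hx] at * <;> rw [hy] at * <;> subst hu hv
    · exact absurd h h'.asymm
    · rfl

/-! ### The lower bound on f. -/

/-- Adding isolated vertices to a graph with at least `|V(H)|` vertices preserves `H`-freeness. -/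
theorem free_map_of_card_le {W V V' : Type*} [Fintype W] [Fintype V] {H : SimpleGraph W}
    {G : SimpleGraph V} (hG : H.Free G) (f : V ↪ V') (hcard : Fintype.card W ≤ Fintype.card V) :
    H.Free (G.map f) := by
  classical
  rintro ⟨c⟩
  apply hG
  rcases isEmpty_or_nonempty W with hW | ⟨⟨w₀⟩⟩
  · exact ⟨⟨⟨fun w => isEmptyElim w, fun {w} => isEmptyElim w⟩, fun w => isEmptyElim w⟩⟩
  have : Nonempty V := Fintype.card_pos_iff.1 (lt_of_lt_of_le (Fintype.card_pos_iff.2 ⟨w₀⟩) hcard)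
  let g : W → V := fun w => Function.invFun f (c w)
  let s : Finset W := {w | c w ∈ Set.range f}
  have hg : ∀ w ∈ s, f (g w) = c w := fun w hw =>
    Function.invFun_eq (Finset.mem_filter.1 hw).2
  have hinj : Set.InjOn g s := by
    intro w hw w' hw' h
    apply c.injective
    change c w = c w'
    rw [← hg w hw, ← hg w' hw', h]
  -- Vertices of H outside `s` are sent to isolated vertices, hence are isolated in H. They can be
  -- moved to any unused vertices of G, and `hcard` provides the room.
  obtain ⟨t, ht, htc⟩ := Finset.exists_superset_card_eq (s := s.image g) (n := Fintype.card W)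
    (Finset.card_image_le.trans (Finset.card_le_univ s)) hcard
  obtain ⟨e, he⟩ := Finset.exists_equiv_extend_of_card_eq htc.symm ht hinj
  refine ⟨⟨⟨fun w => (e w : V), ?_⟩, fun w w' h => e.injective (Subtype.ext h)⟩⟩
  intro w w' h
  obtain ⟨u, v, huv, h1, h2⟩ := (SimpleGraph.map_adj _ _ _ _).1 (c.toHom.map_adj h)
  have hw : w ∈ s := Finset.mem_filter.2 ⟨Finset.mem_univ _, u, h1⟩
  have hw' : w' ∈ s := Finset.mem_filter.2 ⟨Finset.mem_univ _, v, h2⟩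
  rw [he w hw, he w' hw']
  have e1 : g w = u := f.injective ((hg w hw).trans h1.symm)
  have e2 : g w' = v := f.injective ((hg w' hw').trans h2.symm)
  rwa [e1, e2]

/-- An `H`-free `(n, k)`-graph gives a lower bound on the extremal number. -/
theorem choose_two_le_extremalNumber {W : Type*} [Fintype W] {H : SimpleGraph W} {V : Type*}
    {G : SimpleGraph V} {n k K : ℕ} (hnk : IsNKGraph G n k) (hG : H.Free G)
    (hW : Fintype.card W ≤ n) (hkK : k ≤ K) :
    n.choose 2 ≤ SimpleGraph.extremalNumber (n * K) H := by
  classical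
  rcases Nat.lt_or_ge n 2 with hn | hn
  · simp [Nat.choose_eq_zero_of_lt hn]
  obtain ⟨blob, hsize, hedge⟩ := hnk
  have hfin : ∀ i, (blob.colorClass i).Finite := fun i =>
    Set.finite_of_encard_le_coe (hsize i)
  have hun : (Set.univ : Set V) = ⋃ i, blob.colorClass i := by
    ext v; simp [SimpleGraph.Coloring.colorClass]
  have : Finite V := Set.finite_univ_iff.1 (hun ▸ Set.finite_iUnion hfin)
  have : Fintype V := Fintype.ofFinite V
  have hup : Fintype.card V ≤ n * K := by
    rw [← Finset.card_univ, ← Fintype.card_fin n, ← Finset.card_univ]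
    refine Finset.card_le_mul_card_image_of_maps_to (f := blob) (fun v _ => Finset.mem_univ _) K ?_
      |>.trans_eq (mul_comm _ _)
    intro i _
    refine le_trans ?_ hkK
    have h := hsize i
    rw [Set.encard_eq_coe_toFinset_card, Nat.cast_le] at h
    refine (Finset.card_le_card ?_).trans h
    intro v hv
    exact Set.mem_toFinset.2 (Finset.mem_filter.1 hv).2
  -- With n ≥ 2 every blob meets an edge, so G has at least n ≥ |V(H)| vertices and padding is
  -- allowed.
  have hsurj : Function.Surjective blob := by
    intro i
    have : Nontrivial (Fin n) := Fin.nontrivial_iff_two_le.2 hn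
    obtain ⟨j, hj⟩ := exists_ne i
    obtain ⟨e, he, -⟩ := hedge i j hj.symm
    exact ⟨e.1, he.1⟩
  have hlow : Fintype.card W ≤ Fintype.card V :=
    hW.trans (by simpa using Fintype.card_le_of_surjective _ hsurj)
  obtain ⟨f⟩ : Nonempty (V ↪ Fin (n * K)) :=
    Function.Embedding.nonempty_of_card_le (by simpa using hup)
  have hfree := SimpleGraph.card_edgeFinset_le_extremalNumber (free_map_of_card_le hG f hlow)
  rw [Fintype.card_fin] at hfree
  refine le_trans ?_ hfree
  have h1 : n.choose 2 = (⊤ : SimpleGraph (Fin n)).edgeFinset.card := by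
    rw [SimpleGraph.card_edgeFinset_top_eq_card_choose_two, Fintype.card_fin]
  have h2 : (G.map f).edgeFinset.card = G.edgeFinset.card := by
    simp
  rw [h1, h2]
  refine Finset.card_le_card_of_surjOn (Sym2.map blob) ?_
  intro e he
  induction e with
  | _ i j =>
    have hij : i ≠ j := by simpa using he
    obtain ⟨⟨u, v⟩, ⟨hu, hv, huv⟩, -⟩ := hedge i j hij
    exact ⟨s(u, v), by simpa using huv, by simp_all⟩

/-! ### Degree sums in H-free graphs. -/

open Finset in
/-- In an `H`-free graph, the degrees inside a vertex set are controlled by the extremal number. -/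
theorem sum_card_neighborFinset_inter_le {W V : Type*} [Fintype V] [DecidableEq V]
    {H : SimpleGraph W} {G : SimpleGraph V} [DecidableRel G.Adj] (hG : H.Free G) (X : Finset V) :
    ∑ u ∈ X, #(G.neighborFinset u ∩ X) ≤ 2 * SimpleGraph.extremalNumber #X H := by
  classical
  have hfree : H.Free (G.induce (X : Set V)) := fun h =>
    hG (h.trans ⟨(SimpleGraph.Embedding.induce _).toCopy⟩)
  have h1 := SimpleGraph.card_edgeFinset_le_extremalNumber hfree
  have hc : Fintype.card (X : Set V) = #X := by simp
  rw [hc] at h1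
  have h2 := SimpleGraph.sum_degrees_eq_twice_card_edges (G.induce (X : Set V))
  have h3 : ∑ u ∈ X, #(G.neighborFinset u ∩ X) = ∑ x : (X : Set V), (G.induce (X : Set V)).degree x := by
    rw [← sum_coe_sort X]
    refine Fintype.sum_equiv (Equiv.refl _) _ _ fun x => ?_
    rw [← SimpleGraph.card_neighborFinset_eq_degree]
    symm
    refine card_bij (fun y _ => y.1) ?_ ?_ ?_
    · intro y hy
      simp only [SimpleGraph.mem_neighborFinset, SimpleGraph.comap_adj] at hy
      simp only [mem_inter, SimpleGraph.mem_neighborFinset]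
      exact ⟨hy, y.2⟩
    · intro y _ z _ h; exact Subtype.ext h
    · intro y hy
      simp only [mem_inter, SimpleGraph.mem_neighborFinset] at hy
      exact ⟨⟨y, hy.2⟩, (SimpleGraph.mem_neighborFinset _ _ _).2 hy.1, rfl⟩
  rw [h3, h2]; omega

open Finset in
/-- Degree sum over a vertex set `S` of an `H`-free graph, obtained by cutting the vertex set into
pieces of size `|S|`. -/
theorem sum_degree_le {W : Type*} {H : SimpleGraph W} {N : ℕ} {G : SimpleGraph (Fin N)}
    [DecidableRel G.Adj] (hG : H.Free G) {M b : ℝ} (hM : 0 ≤ M) (hb0 : 0 ≤ b) (hb : b ≤ 2)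
    (hex : ∀ l : ℕ, (SimpleGraph.extremalNumber l H : ℝ) ≤ M * (l : ℝ) ^ b) (S : Finset (Fin N)) :
    ∑ u ∈ S, (G.degree u : ℝ) ≤ 16 * M * N * (#S : ℝ) ^ (b - 1) := by
  rcases S.eq_empty_or_nonempty with rfl | hS
  · rw [sum_empty]; positivity
  set s := #S with hs
  have hs0 : 0 < s := card_pos.2 hS
  have hsN : s ≤ N := by simpa using card_le_univ S
  have hs' : (0 : ℝ) < s := Nat.cast_pos.2 hs0
  -- Intervals of length s: each union `S ∪ P q` has at most 2s vertices, and there are at most N/s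
  -- + 1 ≤ 2N/s of them.
  let P : ℕ → Finset (Fin N) := fun q => {v | (v : ℕ) / s = q}
  have hP : ∀ q, #(P q) ≤ s := by
    intro q
    rw [← card_range s]
    refine card_le_card_of_injOn (fun v => (v : ℕ) % s)
      (fun v _ => by simpa using Nat.mod_lt _ hs0) ?_
    intro v hv w hw h
    have hv' : (v : ℕ) / s = q := by simpa [P] using hv
    have hw' : (w : ℕ) / s = q := by simpa [P] using hw
    ext
    rw [← Nat.div_add_mod v s, ← Nat.div_add_mod w s, hv', hw']
    simpa using h
  have hpiece : ∀ q, ∑ u ∈ S, (#(G.neighborFinset u ∩ P q) : ℝ) ≤ 2 * (M * (2 * s) ^ b) := by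
    intro q
    have h1 : ∑ u ∈ S, #(G.neighborFinset u ∩ P q)
        ≤ ∑ u ∈ S ∪ P q, #(G.neighborFinset u ∩ (S ∪ P q)) :=
      (sum_le_sum fun u _ => card_le_card (inter_subset_inter_left subset_union_right)).trans
        (sum_le_sum_of_subset subset_union_left)
    have h2 := h1.trans (sum_card_neighborFinset_inter_le hG (S ∪ P q))
    have h3 : ((∑ u ∈ S, #(G.neighborFinset u ∩ P q) : ℕ) : ℝ)
        ≤ 2 * (SimpleGraph.extremalNumber #(S ∪ P q) H : ℝ) := by exact_mod_cast h2
    push_cast at h3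
    refine h3.trans ?_
    gcongr
    refine (hex _).trans ?_
    gcongr
    have h4 : #(S ∪ P q) ≤ 2 * s := (card_union_le _ _).trans (by have := hP q; omega)
    exact_mod_cast h4
  have hdeg : ∀ u, (G.degree u : ℝ)
      = ∑ q ∈ range (N / s + 1), (#(G.neighborFinset u ∩ P q) : ℝ) := by
    intro u
    rw [← SimpleGraph.card_neighborFinset_eq_degree, ← Nat.cast_sum]
    congr 1
    rw [card_eq_sum_card_fiberwise (f := fun v : Fin N => (v : ℕ) / s) (t := range (N / s + 1))]
    · refine sum_congr rfl fun q _ => ?_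
      congr 1; ext v; simp [P]
    · intro v _
      simpa [Nat.lt_succ_iff] using Nat.div_le_div_right v.2.le
  calc ∑ u ∈ S, (G.degree u : ℝ)
      = ∑ q ∈ range (N / s + 1), ∑ u ∈ S, (#(G.neighborFinset u ∩ P q) : ℝ) := by
        rw [sum_comm]; exact sum_congr rfl fun u _ => hdeg u
    _ ≤ ∑ q ∈ range (N / s + 1), 2 * (M * (2 * s) ^ b) := sum_le_sum fun q _ => hpiece q
    _ = ((N / s : ℕ) + 1) * (2 * (M * (2 * s) ^ b)) := by simp
    _ ≤ (2 * (N / s)) * (2 * (M * (4 * s ^ b))) := by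
        have h1 : ((N / s : ℕ) : ℝ) + 1 ≤ 2 * (N / s) := by
          have h2 : ((N / s : ℕ) : ℝ) ≤ (N : ℝ) / s := Nat.cast_div_le
          have h3 : (1 : ℝ) ≤ (N : ℝ) / s := by
            rw [le_div_iff₀ hs', one_mul]; exact_mod_cast hsN
          linarith
        have h4 : (2 * (s : ℝ)) ^ b ≤ 4 * s ^ b := by
          rw [Real.mul_rpow (by norm_num) hs'.le]
          gcongr
          calc (2 : ℝ) ^ b ≤ 2 ^ (2 : ℝ) := Real.rpow_le_rpow_of_exponent_le (by norm_num) hb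
            _ = 4 := by norm_num
        gcongr
    _ = 16 * M * N * (s : ℝ) ^ (b - 1) := by
        rw [Real.rpow_sub_one hs'.ne']; field_simp; ring

open Finset in
/-- The vertices of large degree of an `H`-free graph carry few edges. -/
theorem sum_degree_of_large_degree_le {W : Type*} {H : SimpleGraph W} {N : ℕ}
    {G : SimpleGraph (Fin N)} [DecidableRel G.Adj] (hG : H.Free G) {M b : ℝ} (hM : 0 < M)
    (hb1 : 1 < b) (hb : b < 2)
    (hex : ∀ l : ℕ, (SimpleGraph.extremalNumber l H : ℝ) ≤ M * (l : ℝ) ^ b) {D : ℝ} (hD : 0 < D) :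
    ∑ u with D < G.degree u, (G.degree u : ℝ)
      ≤ 16 * M * N * (16 * M * N / D) ^ ((b - 1) / (2 - b)) := by
  set S : Finset (Fin N) := {u | D < G.degree u} with hS
  have h1 := sum_degree_le hG hM.le (by linarith) hb.le hex S
  refine h1.trans ?_
  rcases S.eq_empty_or_nonempty with h | h
  · rw [h, card_empty, Nat.cast_zero, Real.zero_rpow (by linarith), mul_zero]
    positivity
  have hs : (0 : ℝ) < #S := Nat.cast_pos.2 (card_pos.2 h)
  -- Every vertex of S has degree above D, so the degree-sum bound also limits |S|; feeding that
  -- limit back into it gives the claim.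
  have h2 : (#S : ℝ) * D ≤ 16 * M * N * (#S : ℝ) ^ (b - 1) := by
    refine le_trans ?_ h1
    rw [← nsmul_eq_mul]
    exact card_nsmul_le_sum _ _ _ fun u hu => (mem_filter.1 hu).2.le
  have h3 : (#S : ℝ) ^ (2 - b) ≤ 16 * M * N / D := by
    rw [le_div_iff₀ hD, show 2 - b = 1 - (b - 1) by ring, Real.rpow_sub hs, Real.rpow_one,
      div_mul_eq_mul_div, div_le_iff₀ (by positivity)]
    exact h2
  gcongr
  calc (#S : ℝ) ^ (b - 1) = ((#S : ℝ) ^ (2 - b)) ^ ((b - 1) / (2 - b)) := by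
        rw [← Real.rpow_mul hs.le]; congr 1
        have : 2 - b ≠ 0 := by linarith
        field_simp
    _ ≤ _ := by
        apply Real.rpow_le_rpow (by positivity) h3
        exact div_nonneg (by linarith) (by linarith)

/-! ### Splitting a graph by a random colouring. -/

open Finset in
/-- An `H`-free graph on `n * k` vertices that keeps at least `11 n² log n` edges after removing
its vertices of degree above `n / 100` can be split into an `(n, (1 + ε) k)`-graph. -/
theorem exists_mem_splitSizes_le {W : Type*} {H : SimpleGraph W} {n k : ℕ}
    {G : SimpleGraph (Fin (n * k))} [DecidableRel G.Adj] (hG : H.Free G) (hk : 0 < k)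
    (hn : 2 ≤ Real.log n) {ε : ℝ} (hε : 0 < ε) (hε1 : ε ≤ 1)
    (hnk : n * Real.exp (-(ε ^ 2 / 4 * k)) < 1 / 2)
    (hdeg : 22 * (n : ℝ) ^ 2 * Real.log n ≤ ∑ u, (G.degree u : ℝ)
      - 2 * ∑ u with (n : ℝ) / 100 < G.degree u, (G.degree u : ℝ)) :
    ∃ K ∈ splitSizes n H, (K : ℝ) ≤ (1 + ε) * k := by
  have hn0 : 0 < n := by
    rcases Nat.eq_zero_or_pos n with h | h
    · rw [h] at hn; simp at hn; linarith
    · exact h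
  have hn' : (0 : ℝ) < n := Nat.cast_pos.2 hn0
  set S : Finset (Fin (n * k)) := {u | (n : ℝ) / 100 < G.degree u} with hS
  let nb : Fin (n * k) → Finset (Fin (n * k)) := fun u => {v | G.Adj u v ∧ u ∉ S ∧ v ∉ S}
  have hmem : ∀ u v, v ∈ nb u ↔ G.Adj u v ∧ u ∉ S ∧ v ∉ S := fun u v => by simp [nb]
  have hsymm : ∀ u v, v ∈ nb u ↔ u ∈ nb v := fun u v => by
    rw [hmem, hmem, G.adj_comm]; tauto
  have hnb : ∀ u, (#(nb u) : ℝ) ≤ n / 100 := by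
    intro u
    by_cases hu : u ∈ S
    · have : nb u = ∅ := by ext v; simp [hmem, hu]
      rw [this]; simp; positivity
    · have h1 : (G.degree u : ℝ) ≤ n / 100 := by simpa [hS] using hu
      refine le_trans (Nat.cast_le.2 ?_) h1
      rw [← SimpleGraph.card_neighborFinset_eq_degree]
      exact card_le_card fun v hv => by simpa using ((hmem u v).1 hv).1
  have htotal : 22 * (n : ℝ) ^ 2 * Real.log n ≤ ∑ u, (#(nb u) : ℝ) := by
    refine hdeg.trans ?_
    -- An edge meeting S is lost at both ends; both losses are charged to degrees in S, whence the
    -- factor 2 in `hdeg`.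
    have h1 : ∀ u, G.degree u ≤ #(nb u) + (if u ∈ S then G.degree u else 0)
        + #{v ∈ S | G.Adj v u} := by
      intro u
      by_cases hu : u ∈ S
      · simp [hu]; omega
      · rw [if_neg hu, add_zero, ← SimpleGraph.card_neighborFinset_eq_degree]
        refine (card_le_card ?_).trans (card_union_le _ _)
        intro v hv
        have hv' : G.Adj u v := by simpa using hv
        by_cases hvS : v ∈ S
        · exact mem_union_right _ (mem_filter.2 ⟨hvS, hv'.symm⟩)
        · exact mem_union_left _ ((hmem u v).2 ⟨hv', hu, hvS⟩)
    have h2 : ∑ u, #{v ∈ S | G.Adj v u} = ∑ v ∈ S, G.degree v := by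
      have := sum_card_bipartiteAbove_eq_sum_card_bipartiteBelow (s := S) (t := univ) G.Adj
      rw [show ∑ u, #{v ∈ S | G.Adj v u} = ∑ u, #(S.bipartiteBelow G.Adj u) from rfl, ← this]
      refine sum_congr rfl fun v _ => ?_
      rw [← SimpleGraph.card_neighborFinset_eq_degree]
      congr 1; ext w; simp [bipartiteAbove]
    have h3 := sum_le_sum fun u (_ : u ∈ (univ : Finset (Fin (n * k)))) => h1 u
    rw [sum_add_distrib, sum_add_distrib, h2, sum_ite_mem, univ_inter] at h3
    have h4 : (∑ u, (G.degree u : ℝ)) ≤ ∑ u, (#(nb u) : ℝ) + ∑ u ∈ S, (G.degree u : ℝ)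
        + ∑ u ∈ S, (G.degree u : ℝ) := by exact_mod_cast h3
    linarith
  obtain ⟨A, -, hA⟩ := exists_large_cut (fun u v => if v ∈ nb u then 1 else 0)
    (fun u v => by simp only [hsymm u v]) (fun u => by simp [hmem]) univ
  have hcut : 11 / 2 * (n : ℝ) ^ 2 * Real.log n ≤ ∑ u ∈ A, (#(nb u \ A) : ℝ) := by
    have h1 : ∑ u, ∑ v, (if v ∈ nb u then 1 else 0) = ∑ u, #(nb u) :=
      sum_congr rfl fun u _ => by simp
    have h2 : ∑ u ∈ A, ∑ v ∈ univ \ A, (if v ∈ nb u then 1 else 0) = ∑ u ∈ A, #(nb u \ A) :=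
      sum_congr rfl fun u _ => by
        rw [← card_filter]; congr 1; ext v; simp [and_comm]
    rw [h1, h2] at hA
    have h3 : (∑ u, (#(nb u) : ℝ)) ≤ 4 * ∑ u ∈ A, (#(nb u \ A) : ℝ) := by exact_mod_cast hA
    linarith
  let bad : Fin n × Fin n → Finset (Fin (n * k) → Fin n) := fun ij =>
    {φ | ∀ u ∈ A, ∀ v ∈ nb u, v ∉ A → φ u = ij.1 → φ v ≠ ij.2}
  let big : Fin n → Finset (Fin (n * k) → Fin n) := fun i =>
    {φ | (1 + ε) * k < #{v | φ v = i}}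
  have hbad : ∀ ij, (#(bad ij) : ℝ)
      ≤ (n : ℝ) ^ (n * k) * Real.exp (-(11 / 4 * Real.log n)) := by
    intro ij
    have h := card_colorings_avoiding_le nb hn0 le_rfl hnb hsymm A ij.1 ij.2
    rw [Fintype.card_fin] at h
    refine (le_of_eq (by simp only [bad]; congr!)).trans (h.trans ?_)
    gcongr
    rw [le_div_iff₀ (by positivity)]
    linarith
  have hbig : ∀ i, (#(big i) : ℝ) ≤ (n : ℝ) ^ (n * k) * Real.exp (-(ε ^ 2 / 4 * k)) := by
    intro i
    have h := card_colorings_large_class_le (V := Fin (n * k)) hn0 (Fintype.card_fin _) hε hε1 i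
    rwa [Fintype.card_fin] at h
  -- The sum is n^(-3/4), and log n ≥ 2 gives n^(3/4) ≥ 1 + 3/2 > 2.
  have hpairs : (n : ℝ) ^ 2 * Real.exp (-(11 / 4 * Real.log n)) < 1 / 2 := by
    have h1 : (n : ℝ) ^ 2 = Real.exp (2 * Real.log n) := by
      rw [mul_comm, Real.exp_mul, Real.exp_log hn']; norm_cast
    rw [h1, ← Real.exp_add, show 2 * Real.log n + -(11 / 4 * Real.log n) = -(3 / 4 * Real.log n) by
      ring, Real.exp_neg, inv_eq_one_div]
    apply one_div_lt_one_div_of_lt (by norm_num)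
    linarith [Real.add_one_le_exp (3 / 4 * Real.log n)]
  have hex : ∃ φ, φ ∉ univ.biUnion bad ∪ univ.biUnion big := by
    by_contra! hcon
    have h1 : (univ : Finset (Fin (n * k) → Fin n)) ⊆ univ.biUnion bad ∪ univ.biUnion big :=
      fun φ _ => hcon φ
    have h2 : (n : ℝ) ^ (n * k) ≤ ∑ ij, (#(bad ij) : ℝ) + ∑ i, (#(big i) : ℝ) := by
      have := (card_le_card h1).trans ((card_union_le _ _).trans
        (add_le_add card_biUnion_le card_biUnion_le))
      rw [card_univ, Fintype.card_fun, Fintype.card_fin, Fintype.card_fin] at this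
      exact_mod_cast this
    have h3 := sum_le_sum fun ij (_ : ij ∈ (univ : Finset (Fin n × Fin n))) => hbad ij
    have h4 := sum_le_sum fun i (_ : i ∈ (univ : Finset (Fin n))) => hbig i
    rw [sum_const, card_univ, Fintype.card_prod, Fintype.card_fin, nsmul_eq_mul] at h3
    rw [sum_const, card_univ, Fintype.card_fin, nsmul_eq_mul] at h4
    push_cast at h3
    have h5 : (0 : ℝ) < (n : ℝ) ^ (n * k) := by positivity
    nlinarith
  obtain ⟨φ, hφ⟩ := hex
  simp only [mem_union, mem_biUnion, mem_univ, true_and, not_or, not_exists] at hφ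
  obtain ⟨hφ1, hφ2⟩ := hφ
  refine ⟨⌊(1 + ε) * k⌋₊, mem_splitSizes_of_coloring hG ?_ φ ?_ ?_,
    Nat.floor_le (by positivity)⟩
  · refine Nat.floor_pos.2 ?_
    have : (1 : ℝ) ≤ k := by exact_mod_cast hk
    nlinarith
  · intro i
    have h := hφ2 i
    simp only [big, mem_filter, mem_univ, true_and, not_lt] at h
    have h' := Nat.le_floor h
    rw [Set.encard_eq_coe_toFinset_card, Nat.cast_le]
    refine le_trans (card_le_card ?_) h'
    intro v hv
    simpa using hv
  · intro i j _
    have h := hφ1 (i, j)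
    simp only [bad, mem_filter, mem_univ, true_and] at h
    push Not at h
    obtain ⟨u, _, v, hv, _, hu1, hv1⟩ := h
    exact ⟨u, v, hu1, hv1, ((hmem u v).1 hv).1⟩

/-! ### Asymptotics of the exponents. -/

/-- Comparable power bounds force `a ≤ b`. -/
theorem exponent_le_of_eventually {a b C C' : ℝ} (hC : 0 < C)
    (h : ∀ᶠ l : ℕ in atTop, C * (l : ℝ) ^ a ≤ C' * (l : ℝ) ^ b) : a ≤ b := by
  by_contra! hab
  have h1 : Tendsto (fun l : ℕ => (l : ℝ) ^ (a - b)) atTop atTop :=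
    (tendsto_rpow_atTop (sub_pos.2 hab)).comp tendsto_natCast_atTop_atTop
  obtain ⟨l, hl, hl1, hl0⟩ := (h.and ((h1.eventually_gt_atTop (C' / C)).and
    (eventually_gt_atTop 0))).exists
  have hl0' : (0 : ℝ) < l := Nat.cast_pos.2 hl0
  rw [div_lt_iff₀ hC, Real.rpow_sub hl0', div_mul_eq_mul_div, lt_div_iff₀ (by positivity)] at hl1
  linarith

/-- An eventual power bound, valid at `0`, holds everywhere with a larger constant. -/
theorem exists_forall_le_mul_rpow {F : ℕ → ℝ} (hF : ∀ l, 0 ≤ F l) (hF0 : F 0 = 0) {b C' : ℝ}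
    (hb : 0 < b) (hC' : 0 < C') (h : ∀ᶠ l : ℕ in atTop, F l ≤ C' * (l : ℝ) ^ b) :
    ∃ M, 0 < M ∧ ∀ l : ℕ, F l ≤ M * (l : ℝ) ^ b := by
  obtain ⟨l₀, hl₀⟩ := eventually_atTop.1 h
  have hsum : 0 ≤ ∑ i ∈ Finset.range l₀, F i := Finset.sum_nonneg fun i _ => hF i
  refine ⟨C' + ∑ i ∈ Finset.range l₀, F i, by linarith, fun l => ?_⟩
  rcases Nat.eq_zero_or_pos l with rfl | hl
  · simp [hF0, Real.zero_rpow hb.ne']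
  rcases le_or_gt l₀ l with h1 | h1
  · refine (hl₀ l h1).trans ?_
    gcongr
    linarith
  · have h2 : F l ≤ ∑ i ∈ Finset.range l₀, F i :=
      Finset.single_le_sum (fun i _ => hF i) (Finset.mem_range.2 h1)
    have h3 : (1 : ℝ) ≤ (l : ℝ) ^ b := Real.one_le_rpow (by exact_mod_cast hl) hb.le
    nlinarith

/-- `12 n² log n ≤ F (n k) ≤ M (n k)^b` forces `k` to grow polynomially in `n`. -/
theorem eventually_mul_rpow_le {F : ℕ → ℝ} {b M : ℝ} (hb : 0 < b) (hM : 0 < M)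
    (hF : ∀ l : ℕ, F l ≤ M * (l : ℝ) ^ b) :
    ∀ᶠ n : ℕ in atTop, ∀ k : ℕ, 12 * (n : ℝ) ^ 2 * Real.log n ≤ F (n * k) →
      M⁻¹ ^ (1 / b) * (n : ℝ) ^ (2 / b - 1) ≤ k := by
  filter_upwards [eventually_gt_atTop 0, (Real.tendsto_log_atTop.comp
    tendsto_natCast_atTop_atTop).eventually_ge_atTop 1] with n hn hlog k hk
  have hlog' : 1 ≤ Real.log n := hlog
  have hn' : (0 : ℝ) < n := Nat.cast_pos.2 hn
  have h1 : (n : ℝ) ^ 2 ≤ M * ((n * k : ℕ) : ℝ) ^ b := by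
    refine le_trans ?_ (hk.trans (hF _))
    nlinarith [pow_pos hn' 2]
  have h2 : M⁻¹ * (n : ℝ) ^ 2 ≤ ((n * k : ℕ) : ℝ) ^ b := by
    rwa [inv_mul_le_iff₀ hM]
  have h3 : (M⁻¹ * (n : ℝ) ^ 2) ^ (1 / b) ≤ n * k := by
    calc (M⁻¹ * (n : ℝ) ^ 2) ^ (1 / b) ≤ (((n * k : ℕ) : ℝ) ^ b) ^ (1 / b) := by gcongr
      _ = n * k := by
        rw [← Real.rpow_mul (Nat.cast_nonneg _), mul_one_div_cancel hb.ne', Real.rpow_one]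
        push_cast; rfl
  have h4 : (M⁻¹ * (n : ℝ) ^ 2) ^ (1 / b) = n * (M⁻¹ ^ (1 / b) * (n : ℝ) ^ (2 / b - 1)) := by
    rw [Real.mul_rpow (by positivity) (by positivity), ← Real.rpow_natCast, ← Real.rpow_mul hn'.le,
      Real.rpow_sub_one hn'.ne']
    push_cast
    rw [mul_one_div]
    field_simp
  rw [h4] at h3
  exact le_of_mul_le_mul_left h3 (Nat.cast_pos.2 hn)

/-- `n` times a quantity exponentially small in a power of `n` tends to `0`. -/
theorem tendsto_mul_exp_neg_mul_rpow {c η : ℝ} (hc : 0 < c) (hη : 0 < η) :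
    Tendsto (fun n : ℕ => (n : ℝ) * Real.exp (-(c * (n : ℝ) ^ η))) atTop (nhds 0) := by
  have h1 := tendsto_rpow_mul_exp_neg_mul_atTop_nhds_zero (1 / η) c hc
  have h2 : Tendsto (fun n : ℕ => (n : ℝ) ^ η) atTop atTop :=
    (tendsto_rpow_atTop hη).comp tendsto_natCast_atTop_atTop
  refine (h1.comp h2).congr fun n => ?_
  simp only [Function.comp]
  rw [← Real.rpow_mul (Nat.cast_nonneg _), mul_one_div_cancel hη.ne', Real.rpow_one, neg_mul]

/-- A larger power eventually dominates any multiple of a smaller one. -/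
theorem eventually_mul_rpow_le_mul_rpow {a a' K c : ℝ} (hc : 0 < c) (haa : a' < a) :
    ∀ᶠ l : ℕ in atTop, K * (l : ℝ) ^ a' ≤ c * (l : ℝ) ^ a := by
  have h1 : Tendsto (fun l : ℕ => (l : ℝ) ^ (a - a')) atTop atTop :=
    (tendsto_rpow_atTop (sub_pos.2 haa)).comp tendsto_natCast_atTop_atTop
  filter_upwards [h1.eventually_ge_atTop (K / c), eventually_gt_atTop 0] with l hl hl0
  have hl0' : (0 : ℝ) < l := Nat.cast_pos.2 hl0
  rw [div_le_iff₀ hc, Real.rpow_sub hl0', div_mul_eq_mul_div, le_div_iff₀ (by positivity)] at hl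
  linarith

/-- If `m ≥ N / 2` and `m ^ a ≲ n² log n`, then `N ^ θ ≤ n` for every `θ < a / 2`. -/
theorem eventually_rpow_le_of_lt {a θ C : ℝ} (hC : 0 < C) (hθ : 0 < θ) (hθa : 2 * θ < a) :
    ∀ᶠ n : ℕ in atTop, ∀ N m : ℝ, 0 ≤ N → N ≤ 2 * m →
      C * m ^ a < 12 * (n : ℝ) ^ 2 * Real.log n → N ^ θ ≤ n := by
  have ha : 0 < a := by linarith
  -- The surplus exponent a/θ - 2 absorbs the logarithm and the constants.
  have hr : 0 < a / θ - 2 := by rw [sub_pos, lt_div_iff₀ hθ]; exact hθa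
  have hlog := (isLittleO_log_rpow_atTop hr).comp_tendsto
    (tendsto_natCast_atTop_atTop (R := ℝ))
  have hK : 0 < (2 : ℝ) ^ a * 12 / C := by positivity
  filter_upwards [hlog.bound (inv_pos.2 hK), eventually_gt_atTop 0] with n hn hn0 N m hN hNm hm
  have hn' : (0 : ℝ) < n := Nat.cast_pos.2 hn0
  have hm0 : 0 ≤ m := by linarith
  have h1 : Real.log n ≤ ((2 : ℝ) ^ a * 12 / C)⁻¹ * (n : ℝ) ^ (a / θ - 2) := by
    have h2 := (le_abs_self _).trans hn
    simpa [abs_of_nonneg (Real.rpow_nonneg hn'.le _)] using h2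
  have h3 : N ^ a ≤ (n : ℝ) ^ (a / θ) := by
    calc N ^ a ≤ (2 * m) ^ a := by gcongr
      _ = 2 ^ a * m ^ a := Real.mul_rpow (by norm_num) hm0
      _ ≤ 2 ^ a * (12 * (n : ℝ) ^ 2 * Real.log n / C) := by
          gcongr
          rw [le_div_iff₀ hC]; linarith
      _ = (2 : ℝ) ^ a * 12 / C * Real.log n * (n : ℝ) ^ 2 := by ring
      _ ≤ (n : ℝ) ^ (a / θ - 2) * (n : ℝ) ^ 2 := by
          gcongr
          rwa [← le_inv_mul_iff₀ hK]
      _ = (n : ℝ) ^ (a / θ) := by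
          rw [← Real.rpow_natCast, ← Real.rpow_add hn']; congr 1; push_cast; ring
  calc N ^ θ = (N ^ a) ^ (θ / a) := by
        rw [← Real.rpow_mul hN]; congr 1; field_simp
    _ ≤ ((n : ℝ) ^ (a / θ)) ^ (θ / a) := by gcongr
    _ = n := by
        rw [← Real.rpow_mul hn'.le, show a / θ * (θ / a) = 1 by field_simp, Real.rpow_one]

/-- The estimates that make the random splitting work. -/
theorem eventually_splitting_estimates {F : ℕ → ℝ} {a b C M ε : ℝ} (hC : 0 < C) (hM : 0 < M)
    (hb1 : 1 < b) (hb : b < 2) (hab : b - a < (2 - b) * (b - 1) / (5 - b)) (hε : 0 < ε)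
    (hlow : ∀ᶠ l : ℕ in atTop, C * (l : ℝ) ^ a ≤ F l) (hup : ∀ l : ℕ, F l ≤ M * (l : ℝ) ^ b) :
    ∀ᶠ n : ℕ in atTop, ∀ k : ℕ, 12 * (n : ℝ) ^ 2 * Real.log n ≤ F (n * k) →
      F (n * (k - 1)) < 12 * (n : ℝ) ^ 2 * Real.log n →
        0 < k ∧ 2 ≤ Real.log n ∧ n * Real.exp (-(ε ^ 2 / 4 * k)) < 1 / 2 ∧
        16 * M * ((n * k : ℕ) : ℝ) * (16 * M * ((n * k : ℕ) : ℝ) / (n / 100)) ^ ((b - 1) / (2 - b))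
          ≤ F (n * k) / 12 := by
  have h5 : 0 < 5 - b := by linarith
  -- Chosen so that 2θ < a is exactly the hypothesis on b - a; the second requirement 1 + (1 - θ)ρ <
  -- a then follows with room (b - 1)/(5 - b).
  set θ : ℝ := (b + 1) / (5 - b) with hθ
  set ρ : ℝ := (b - 1) / (2 - b) with hρ
  have hρ0 : 0 ≤ ρ := div_nonneg (by linarith) (by linarith)
  have hθ0 : 0 < θ := div_pos (by linarith) h5
  have hθa : 2 * θ < a := by
    have : 2 * θ = b - (2 - b) * (b - 1) / (5 - b) := by rw [hθ]; field_simp; ring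
    linarith
  have hexp : 1 + (1 - θ) * ρ < a := by
    have h1 : 1 + (1 - θ) * ρ = 2 * θ - (b - 1) / (5 - b) := by
      have : 2 - b ≠ 0 := by linarith
      rw [hθ, hρ]; field_simp; ring
    have h2 : 0 < (b - 1) / (5 - b) := div_pos (by linarith) h5
    linarith
  have hη : 0 < 2 / b - 1 := by rw [sub_pos, lt_div_iff₀ (by linarith)]; linarith
  set c : ℝ := M⁻¹ ^ (1 / b) with hc
  have hc0 : 0 < c := by positivity
  have hkbig : Tendsto (fun n : ℕ => c * (n : ℝ) ^ (2 / b - 1)) atTop atTop :=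
    ((tendsto_rpow_atTop hη).comp tendsto_natCast_atTop_atTop).const_mul_atTop hc0
  have hsmall := tendsto_mul_exp_neg_mul_rpow (c := ε ^ 2 / 4 * c) (by positivity) hη
  filter_upwards [eventually_gt_atTop 0, eventually_mul_rpow_le (by linarith) hM hup,
    hkbig.eventually_ge_atTop 2, hsmall.eventually_lt_const (show (0 : ℝ) < 1 / 2 by norm_num),
    (Real.tendsto_log_atTop.comp tendsto_natCast_atTop_atTop).eventually_ge_atTop 2,
    eventually_rpow_le_of_lt hC hθ0 hθa, eventually_forall_ge_atTop.2 hlow,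
    eventually_forall_ge_atTop.2 (eventually_mul_rpow_le_mul_rpow (K := 16 * M * (1600 * M) ^ ρ)
      (c := C / 12) (by positivity) hexp)] with n hn hkn h2 hsm hlog hNn hlow' hdom k hk hk1
  have hn' : (0 : ℝ) < n := Nat.cast_pos.2 hn
  have hkc := hkn k hk
  have hk2 : (2 : ℝ) ≤ k := h2.trans hkc
  have hk2' : 2 ≤ k := by exact_mod_cast hk2
  refine ⟨by omega, hlog, ?_, ?_⟩
  · refine lt_of_le_of_lt ?_ hsm
    rw [mul_assoc]
    gcongr
  · have hnN : n ≤ n * k := Nat.le_mul_of_pos_right n (by omega)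
    have hnm : n ≤ n * (k - 1) := Nat.le_mul_of_pos_right n (by omega)
    set N : ℝ := ((n * k : ℕ) : ℝ) with hN
    have hN0 : 0 < N := hn'.trans_le (Nat.cast_le.2 hnN)
    -- Uses k ≥ 2, so that k ≤ 2(k - 1) and the upper bound at k - 1 controls N.
    have hNm : N ≤ 2 * ((n * (k - 1) : ℕ) : ℝ) := by
      have : n * k ≤ 2 * (n * (k - 1)) := by
        rw [← mul_assoc, mul_comm 2 n, mul_assoc]; exact Nat.mul_le_mul_left n (by omega)
      rw [hN]; exact_mod_cast this
    have hNθ : N ^ θ ≤ n := hNn N _ hN0.le hNm ((hlow' _ hnm).trans_lt hk1)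
    have hdiv : N / n ≤ N ^ (1 - θ) := by
      rw [Real.rpow_sub hN0, Real.rpow_one]
      gcongr
    calc 16 * M * N * (16 * M * N / (n / 100)) ^ ρ
        = 16 * M * N * (1600 * M * (N / n)) ^ ρ := by congr 2; field_simp; ring
      _ ≤ 16 * M * N * (1600 * M * N ^ (1 - θ)) ^ ρ := by gcongr
      _ = 16 * M * (1600 * M) ^ ρ * N ^ (1 + (1 - θ) * ρ) := by
          rw [Real.mul_rpow (by positivity) (by positivity), ← Real.rpow_mul hN0.le,
            Real.rpow_add hN0, Real.rpow_one]
          ring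
      _ ≤ C / 12 * N ^ a := hdom _ hnN
      _ ≤ F (n * k) / 12 := by linarith [hlow' _ hnN]

/-! ### Assembling the two bounds. -/

theorem theorem1 {W : Type*} [Fintype W] (H : SimpleGraph W)
    (hbip : H.IsBipartite) (hforest : ¬ H.IsAcyclic)
    (a b C C' : ℝ) (hC : 0 < C) (hC' : 0 < C') (hb : b < 2)
    (hex : ∀ᶠ l : ℕ in atTop,
      C * (l : ℝ) ^ a ≤ (SimpleGraph.extremalNumber l H : ℝ) ∧
      (SimpleGraph.extremalNumber l H : ℝ) ≤ C' * (l : ℝ) ^ b)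
    (hab : b - a < (2 - b) * (b - 1) / (5 - b)) :
    -- `f(n,H) ≤ k + o(k)` as `n → ∞`, uniformly over all admissible `k`
    (∀ ε : ℝ, 0 < ε → ∀ᶠ n : ℕ in atTop, ∀ k : ℕ,
      12 * (n : ℝ) ^ 2 * Real.log n ≤ (SimpleGraph.extremalNumber (n * k) H : ℝ) →
        (splitNumber n H : ℝ) ≤ k + ε * k) ∧
    (∀ n k : ℕ, Fintype.card W ≤ n →
      SimpleGraph.extremalNumber (n * k) H < n.choose 2 →
        k ≤ splitNumber n H) := by
  classical
  constructor
  · intro ε hε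
    have hle : a ≤ b := exponent_le_of_eventually hC (hex.mono fun l h => h.1.trans h.2)
    -- Since b - a ≥ 0, the right-hand side of `hab` is positive.
    have hb1 : 1 < b := by
      have h1 : 0 < (2 - b) * (b - 1) / (5 - b) := by linarith
      have h2 := (div_pos_iff_of_pos_right (by linarith)).1 h1
      linarith [(mul_pos_iff_of_pos_left (by linarith)).1 h2]
    have hF0 : SimpleGraph.extremalNumber 0 H = 0 := by
      have := (SimpleGraph.extremalNumber_le_iff (V := Fin 0) H 0).2 fun G _ _ => by
        simp [Subsingleton.elim G ⊥]
      simpa using this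
    obtain ⟨M, hM, hup⟩ := exists_forall_le_mul_rpow
      (F := fun l => (SimpleGraph.extremalNumber l H : ℝ)) (fun l => Nat.cast_nonneg _)
      (by simp [hF0]) (by linarith) hC' (hex.mono fun l h => h.2)
    have hHbot : H ≠ ⊥ := by
      rintro rfl
      exact hforest SimpleGraph.isAcyclic_bot
    -- The Chernoff estimate is for ε ≤ 1.
    have hε' : 0 < min ε 1 := lt_min hε one_pos
    filter_upwards [eventually_splitting_estimates hC hM hb1 hb hab hε'
      (hex.mono fun l h => h.1) hup, eventually_gt_atTop 1] with n hest hn1 k hk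
    -- Since f(n, H) does not depend on k, bounding it through the least admissible k₀ covers every
    -- admissible k; this is the source of uniformity.
    have hex' : ∃ k : ℕ, 12 * (n : ℝ) ^ 2 * Real.log n
        ≤ (SimpleGraph.extremalNumber (n * k) H : ℝ) := ⟨k, hk⟩
    have hk0 := Nat.find_spec hex'
    have hmin := Nat.find_min' hex' hk
    have hlt : (SimpleGraph.extremalNumber (n * (Nat.find hex' - 1)) H : ℝ)
        < 12 * (n : ℝ) ^ 2 * Real.log n := by
      -- At k₀ = 0 the subtraction truncates to 0, where the extremal number vanishes.
      rcases Nat.eq_zero_or_pos (Nat.find hex') with h | h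
      · rw [h]
        have : 0 < Real.log n := Real.log_pos (by exact_mod_cast hn1)
        simp only [zero_tsub, mul_zero, hF0, Nat.cast_zero]
        positivity
      · exact not_le.1 (Nat.find_min hex' (by omega))
    generalize Nat.find hex' = k₀ at hk0 hmin hlt
    obtain ⟨hkpos, hlog, hexp, hsum⟩ := hest k₀ hk0 hlt
    obtain ⟨G, _, hG⟩ := SimpleGraph.exists_isExtremal_free (V := Fin (n * k₀)) hHbot
    have hedges := SimpleGraph.card_edgeFinset_of_isExtremal_free hG
    rw [Fintype.card_fin] at hedges
    have hdeg : ∑ u, (G.degree u : ℝ) = 2 * (SimpleGraph.extremalNumber (n * k₀) H : ℝ) := by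
      rw [← hedges]
      exact_mod_cast G.sum_degrees_eq_twice_card_edges
    have hlarge := sum_degree_of_large_degree_le hG.prop hM hb1 hb hup
      (D := (n : ℝ) / 100) (by positivity)
    -- With F = ex(nk₀, H), the degree condition reads 2F - 2F/12 = 11F/6 ≥ 22n² log n; this is
    -- where the constant 12 is used.
    obtain ⟨K, hK, hKle⟩ := exists_mem_splitSizes_le hG.prop hkpos hlog hε' (min_le_right _ _) hexp
      (by rw [hdeg]; linarith)
    calc (splitNumber n H : ℝ) ≤ K := Nat.cast_le.2 (Nat.sInf_le hK)
      _ ≤ (1 + min ε 1) * k₀ := hKle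
      _ ≤ (1 + ε) * k := by
          gcongr
          exact min_le_left _ _
      _ = k + ε * k := by ring
  · intro n k hW hlt
    refine le_csInf (splitSizes_nonempty n H hforest) ?_
    rintro K ⟨-, V, G, hnk, hG⟩
    by_contra! hK
    exact absurd hlt (not_lt.2 (choose_two_le_extremalNumber hnk hG hW hK.le))
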